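/- Let $\omega$ be a free ultrafilter on $\mathbb{N}$. For a sequence $(A_i)_i$ of $C^*$-algebras, let $\prod_{i\to\omega}A_i$ be the ultraproduct, i.e. the quotient of the $C^*$-algebra of bounded sequences $(a_i)_i$, $a_i\in A_i$, by the ideal of sequences with $\lim_{i\to\omega}\|a_i\|=0$. An element of a $C^*$-algebra $A$ is called full if it generates $A$ as a closed two-sided ideal, and a $^*$-homomorphism is called full if it maps every nonzero element to a full element. A completely positive map is of order zero if it sends orthogonal positive elements to orthogonal elements. A Kirchberg algebra is a simple, separable, nuclear, purely infinite $C^*$-algebra, and a $C^*$-algebra $J$ is stable if $J\cong J\otimes\mathbb{K}$, where $\mathbb{K}$ is the algebra of compact operators on $\ell^2(\mathbb{N})$. Let $\bigl(0\to J_i\to A_i\xrightarrow{\pi_i}B_i\to 0\bigr)_{i\in\mathbb{N}}$ be a sequence of unital extensions of $C^*$-algebras (that is, short exact sequences with each $A_i$ unital), where each $B_i$ is a Kirchberg algebra and each $J_i$ is stable. Let $\pi_\omega:\prod_{i\to\omega}A_i\to\prod_{i\to\omega}B_i$ be the induced $^*$-homomorphism. (i) An element $a\in\prod_{i\to\omega}A_i$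 is full if and only if $\pi_\omega(a)\neq 0$. (ii) Let $D$ be a simple unital $C^*$-algebra, let $\phi:D\to\prod_{i\to\omega}A_i$ be a completely positive and contractive order zero map, and let $\Phi:C_0(0,1]\otimes D\to\prod_{i\to\omega}A_i$ be the corresponding $^*$-homomorphism, characterised by $\Phi(\mathrm{id}_{(0,1]}\otimes d)=\phi(d)$ for all $d\in D$. Then the following are equivalent: (a) the element $\pi_\omega(\phi(1))$ of $\prod_{i\to\omega}B_i$ has spectrum $[0,1]$; (b) the map $\pi_\omega\circ\Phi$ is injective; (c) the map $\Phi$ is full. -/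

import Mathlib

open scoped CStarAlgebra ZeroAtInfty ENNReal

noncomputable section

/-! ### Ideals, fullness, simplicity -/

/-- `b` lies in the closed two-sided ideal generated by `a`. (A closed two-sided ring ideal of a
C*-algebra is automatically a complex subspace.) -/
def MemClosedIdealSpan {A : Type*} [NonUnitalRing A] [TopologicalSpace A] (a b : A) : Prop :=
  ∀ I : TwoSidedIdeal A, IsClosed (I : Set A) → a ∈ I → b ∈ I

/-- An element is full if it generates the whole algebra as a closed two-sided ideal. -/
def IsFullElement {A : Type*} [NonUnitalRing A] [TopologicalSpace A] (a : A) : Prop :=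
  ∀ b : A, MemClosedIdealSpan a b

/-- A *-homomorphism is full if it sends every nonzero element to a full element. -/
def IsFullHom {A B : Type*} [NonUnitalCStarAlgebra A] [NonUnitalCStarAlgebra B]
    (Φ : A →⋆ₙₐ[ℂ] B) : Prop :=
  ∀ a : A, a ≠ 0 → IsFullElement (Φ a)

/-- A (unital) C*-algebra is simple if it is nonzero and its only closed two-sided ideals are
zero and the whole algebra. -/
def IsSimpleCStar (A : Type*) [CStarAlgebra A] : Prop :=
  Nontrivial A ∧ ∀ I : TwoSidedIdeal A, IsClosed (I : Set A) → I = ⊥ ∨ I = ⊤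

/-! ### Kirchberg algebras -/

/-- A unital C*-algebra is purely infinite (in the sense of Kirchberg and Rørdam) if it has no
characters and, whenever `a`, `b` are positive and `b` lies in the closed two-sided ideal
generated by `a`, there are `r` with `r⋆ a r` arbitrarily close to `b`. -/
def IsPurelyInfinite (A : Type*) [CStarAlgebra A] [PartialOrder A] [StarOrderedRing A] : Prop :=
  IsEmpty (A →⋆ₐ[ℂ] ℂ) ∧
    ∀ a b : A, 0 ≤ a → 0 ≤ b → MemClosedIdealSpan a b →
      ∀ ε : ℝ, 0 < ε → ∃ r : A, ‖star r * a * r - b‖ < ε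

/-- A linear map between normed spaces is contractive if its norm is at most one. -/
def IsContractiveMap {F A B : Type*} [FunLike F A B] [Norm A] [Norm B] (φ : F) : Prop :=
  ∀ a : A, ‖φ a‖ ≤ ‖a‖

open scoped ComplexOrder in
/-- A C*-algebra is nuclear (amenable) if its identity map is a point-norm limit of compositions
of c.p.c. maps through matrix algebras `M_n(ℂ)`. -/
def IsNuclearCStar (A : Type*) [NonUnitalCStarAlgebra A] [PartialOrder A] [StarOrderedRing A] :
    Prop :=
  ∀ (F : Finset A) (ε : ℝ), 0 < ε →
    ∃ (n : ℕ) (ψ : A →CP CStarMatrix (Fin n) (Fin n) ℂ)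
      (φ : CStarMatrix (Fin n) (Fin n) ℂ →CP A),
      IsContractiveMap ψ ∧ IsContractiveMap φ ∧ ∀ a ∈ F, ‖a - φ (ψ a)‖ < ε

/-- A unital Kirchberg algebra: a unital C*-algebra that is simple, separable, nuclear and purely
infinite. -/
structure IsKirchberg (A : Type*) [CStarAlgebra A] [PartialOrder A] [StarOrderedRing A] :
    Prop where
  simple : IsSimpleCStar A
  separable : TopologicalSpace.SeparableSpace A
  nuclear : IsNuclearCStar A
  purelyInfinite : IsPurelyInfinite A

/-! ### Stability -/

/-- `e` exhibits the C*-algebra `E` as the stabilisation `C ⊗ 𝕂`, with `e i j c = c ⊗ e_{ij}` for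
the matrix units `e_{ij}` of `𝕂 = 𝕂(ℓ²(ℕ))`.

The first two fields say that `∑ c_{ij} ⊗ e_{ij} ↦ ∑ e i j c_{ij}` is a *-homomorphism on the
*-algebra of finitely supported matrices over `C`, the third one says that it is injective (if it
kills a matrix, multiply on both sides by matrix units), and the last one that its range is dense.
As `⋃ M_n(C)` has exactly one C*-norm, this determines `(E, e)` up to isomorphism, and `E` is the
C*-algebraic inductive limit `C ⊗ 𝕂` of the `M_n(C)` along the corner embeddings. -/
structure IsStabilisation {C E : Type*} [NonUnitalCStarAlgebra C] [NonUnitalCStarAlgebra E]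
    (e : ℕ → ℕ → C →ₗ[ℂ] E) : Prop where
  mul : ∀ (i j k l : ℕ) (a b : C), e i j a * e k l b = if j = k then e i l (a * b) else 0
  star : ∀ (i j : ℕ) (a : C), star (e i j a) = e j i (star a)
  injective : ∀ i j : ℕ, Function.Injective (e i j)
  dense : Dense ((Submodule.span ℂ {x : E | ∃ (i j : ℕ) (a : C), e i j a = x} :
    Submodule ℂ E) : Set E)

/-- A C*-algebra `J` is stable if `J ≅ J ⊗ 𝕂`. -/
def IsStableCStar (J : Type*) [NonUnitalCStarAlgebra J] : Prop :=
  ∃ e : ℕ → ℕ → J →ₗ[ℂ] J, IsStabilisation e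

/-! ### Extensions -/

/-- `0 → J → A → B → 0` is a short exact sequence of C*-algebras, with `A` (hence `B`) unital. -/
structure IsUnitalExtension {J A B : Type*} [NonUnitalCStarAlgebra J] [CStarAlgebra A]
    [CStarAlgebra B] (ι : J →⋆ₙₐ[ℂ] A) (π : A →⋆ₐ[ℂ] B) : Prop where
  injective : Function.Injective ι
  exact : Function.Exact ι π
  surjective : Function.Surjective π

/-! ### Ultraproducts -/

section Ultraproduct

open Filter Topology

variable (ω : Ultrafilter ℕ) (A : ℕ → Type*) [∀ i, CStarAlgebra (A i)] [∀ i, Nontrivial (A i)]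

/-- The ideal of those bounded sequences whose norms tend to zero along `ω`. -/
def nullIdeal : Ideal (lp A ∞) where
  carrier := {a | Tendsto (fun i => ‖a i‖) ω (𝓝 0)}
  zero_mem' := by simp
  add_mem' {a b} ha hb := by
    refine squeeze_zero (fun i => norm_nonneg _) (fun i => ?_) (by simpa using Tendsto.add ha hb)
    simpa using norm_add_le (a i) (b i)
  smul_mem' c a ha := by
    refine squeeze_zero (fun i => norm_nonneg _) (fun i => ?_)
      (by simpa using Tendsto.const_mul ‖c‖ ha)
    refine (norm_mul_le (c i) (a i)).trans ?_
    gcongr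
    exact lp.norm_apply_le_norm (by simp) c i

variable {A}

lemma mem_nullIdeal {a : lp A ∞} :
    a ∈ nullIdeal ω A ↔ Tendsto (fun i => ‖a i‖) ω (𝓝 0) := Iff.rfl

variable (A)

instance nullIdeal.isTwoSided : (nullIdeal ω A).IsTwoSided where
  mul_mem_of_left {a} b ha := by
    rw [mem_nullIdeal] at ha ⊢
    refine squeeze_zero (fun i => norm_nonneg _) (fun i => ?_)
      (by simpa using Tendsto.mul_const ‖b‖ ha)
    refine (norm_mul_le (a i) (b i)).trans ?_
    gcongr
    exact lp.norm_apply_le_norm (by simp) b i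

lemma star_mem_nullIdeal {a : lp A ∞} (ha : a ∈ nullIdeal ω A) : star a ∈ nullIdeal ω A := by
  rw [mem_nullIdeal] at ha ⊢
  simpa using ha

instance nullIdeal.isClosed : IsClosed (nullIdeal ω A : Set (lp A ∞)) := by
  refine isClosed_of_closure_subset fun a ha => ?_
  rw [SetLike.mem_coe, mem_nullIdeal, Metric.tendsto_nhds]
  intro ε hε
  obtain ⟨b, hb, hab⟩ := Metric.mem_closure_iff.1 ha (ε / 2) (half_pos hε)
  have hb' : Tendsto (fun i => ‖b i‖) ω (𝓝 0) := hb
  filter_upwards [(Metric.tendsto_nhds.1 hb') (ε / 2) (half_pos hε)] with i hi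
  have h1 : ‖a i - b i‖ < ε / 2 := by
    rw [dist_eq_norm] at hab
    have h0 : ‖(a - b) i‖ ≤ ‖a - b‖ := lp.norm_apply_le_norm (by simp) (a - b) i
    exact lt_of_le_of_lt (by simpa using h0) hab
  have h2 : ‖a i‖ ≤ ‖a i - b i‖ + ‖b i‖ := by simpa using norm_add_le (a i - b i) (b i)
  simp only [dist_zero_right, norm_norm] at hi ⊢
  linarith

/-- The ultraproduct `∏_{i → ω} A_i`: bounded sequences modulo the sequences that tend to zero in
norm along `ω`, with the quotient norm. -/
def Ultraproduct : Type _ := lp A ∞ ⧸ nullIdeal ω A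

namespace Ultraproduct

instance : Ring (Ultraproduct ω A) := inferInstanceAs (Ring (lp A ∞ ⧸ nullIdeal ω A))

instance : NormedAddCommGroup (Ultraproduct ω A) :=
  inferInstanceAs (NormedAddCommGroup (lp A ∞ ⧸ nullIdeal ω A))

instance : Algebra ℂ (Ultraproduct ω A) :=
  inferInstanceAs (Algebra ℂ (lp A ∞ ⧸ nullIdeal ω A))

instance : CompleteSpace (Ultraproduct ω A) :=
  inferInstanceAs (CompleteSpace (lp A ∞ ⧸ nullIdeal ω A))

variable {A}

/-- The class of a bounded sequence in the ultraproduct. -/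
def mk : lp A ∞ →ₐ[ℂ] Ultraproduct ω A := Ideal.Quotient.mkₐ ℂ (nullIdeal ω A)

lemma mk_surjective : Function.Surjective (mk ω : lp A ∞ → Ultraproduct ω A) :=
  Ideal.Quotient.mk_surjective

variable {ω} in
lemma mk_eq_mk {a b : lp A ∞} : mk ω a = mk ω b ↔ a - b ∈ nullIdeal ω A :=
  Ideal.Quotient.eq

lemma norm_mk_le (a : lp A ∞) : ‖mk ω a‖ ≤ ‖a‖ := Submodule.Quotient.norm_mk_le _ a

lemma exists_norm_lt (x : Ultraproduct ω A) {ε : ℝ} (hε : 0 < ε) :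
    ∃ a : lp A ∞, mk ω a = x ∧ ‖a‖ < ‖x‖ + ε :=
  Submodule.Quotient.norm_mk_lt (S := nullIdeal ω A) x hε

/-- If the norms of a sequence are eventually bounded by `C` along `ω`, then so is the norm of its
class. -/
lemma norm_mk_le_of_eventually (a : lp A ∞) {C : ℝ} (hC : 0 ≤ C)
    (h : ∀ᶠ i in ω, ‖a i‖ ≤ C) : ‖mk ω a‖ ≤ C := by
  classical
  let b : lp A ∞ := ⟨fun i => if ‖a i‖ ≤ C then a i else 0,
    memℓp_infty ⟨C, by rintro _ ⟨i, rfl⟩; dsimp only; split_ifs with hi <;> simp [hi, hC]⟩⟩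
  have hb : ∀ i, b i = if ‖a i‖ ≤ C then a i else 0 := fun _ => rfl
  have hab : mk ω a = mk ω b := by
    rw [mk_eq_mk, mem_nullIdeal]
    refine tendsto_const_nhds.congr' ?_
    filter_upwards [h] with i hi
    simp [hb, hi]
  rw [hab]
  refine (norm_mk_le ω b).trans (lp.norm_le_of_forall_le hC fun i => ?_)
  rw [hb]
  split_ifs with hi <;> simp [hi, hC]

lemma eventually_norm_lt (a : lp A ∞) {C : ℝ} (hC : ‖mk ω a‖ < C) :
    ∀ᶠ i in ω, ‖a i‖ < C := by
  obtain ⟨b, hb, hbn⟩ := exists_norm_lt ω (mk ω a) (half_pos (sub_pos.2 hC))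
  have hab : Tendsto (fun i => ‖(a - b) i‖) ω (𝓝 0) := mk_eq_mk.1 hb.symm
  filter_upwards [(Metric.tendsto_nhds.1 hab) _ (half_pos (sub_pos.2 hC))] with i hi
  have h1 : ‖b i‖ ≤ ‖b‖ := lp.norm_apply_le_norm (by simp) b i
  have h2 : ‖a i‖ ≤ ‖a i - b i‖ + ‖b i‖ := by simpa using norm_add_le (a i - b i) (b i)
  simp only [dist_zero_right, norm_norm, lp.coeFn_sub, Pi.sub_apply] at hi
  linarith

variable (A)

instance : NormedRing (Ultraproduct ω A) where
  dist_eq := dist_eq_norm_neg_add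
  norm_mul_le x y := by
    refine le_of_forall_gt_imp_ge_of_dense fun c hc => ?_
    obtain ⟨δ, hδ, hδc⟩ : ∃ δ > 0, (‖x‖ + δ) * (‖y‖ + δ) < c := by
      have hcont : Tendsto (fun δ : ℝ => (‖x‖ + δ) * (‖y‖ + δ)) (𝓝[>] 0) (𝓝 (‖x‖ * ‖y‖)) := by
        have : Continuous fun δ : ℝ => (‖x‖ + δ) * (‖y‖ + δ) := by fun_prop
        simpa using (this.tendsto 0).mono_left nhdsWithin_le_nhds
      obtain ⟨δ, h1, h2⟩ := ((hcont.eventually_lt_const hc).and self_mem_nhdsWithin).exists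
      exact ⟨δ, h2, h1⟩
    obtain ⟨a, rfl, ha⟩ := exists_norm_lt ω x hδ
    obtain ⟨b, rfl, hb⟩ := exists_norm_lt ω y hδ
    rw [← map_mul]
    calc ‖mk ω (a * b)‖ ≤ ‖a‖ * ‖b‖ := (norm_mk_le ω _).trans (norm_mul_le a b)
      _ ≤ (‖mk ω a‖ + δ) * (‖mk ω b‖ + δ) := by gcongr
      _ ≤ c := hδc.le

instance : NormedAlgebra ℂ (Ultraproduct ω A) where
  norm_smul_le c x :=
    (norm_smul_le (α := ℂ) (β := lp A ∞ ⧸ nullIdeal ω A) c x : _)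

instance : Star (Ultraproduct ω A) where
  star := Quotient.map' (s₁ := Submodule.quotientRel (nullIdeal ω A))
    (s₂ := Submodule.quotientRel (nullIdeal ω A)) star fun a b h => by
      rw [Submodule.quotientRel_def] at h ⊢
      simpa using star_mem_nullIdeal ω A h

variable {A}

lemma star_mk (a : lp A ∞) : star (mk ω a) = mk ω (star a) := rfl

variable (A)

instance : StarRing (Ultraproduct ω A) where
  star_involutive x := by
    obtain ⟨a, rfl⟩ := mk_surjective ω x
    simp [star_mk]
  star_mul x y := by
    obtain ⟨a, rfl⟩ := mk_surjective ω x
    obtain ⟨b, rfl⟩ := mk_surjective ω y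
    rw [← map_mul, star_mk, star_mul, map_mul, star_mk, star_mk]
  star_add x y := by
    obtain ⟨a, rfl⟩ := mk_surjective ω x
    obtain ⟨b, rfl⟩ := mk_surjective ω y
    rw [← map_add, star_mk, star_add, map_add, star_mk, star_mk]

instance : StarModule ℂ (Ultraproduct ω A) where
  star_smul c x := by
    obtain ⟨a, rfl⟩ := mk_surjective ω x
    rw [← map_smul, star_mk, star_smul, map_smul, star_mk]

instance : CStarRing (Ultraproduct ω A) where
  norm_mul_self_le x := by
    obtain ⟨a, rfl⟩ := mk_surjective ω x
    rw [star_mk, ← map_mul]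
    set s := ‖mk ω (star a * a)‖ with hs
    have hs0 : 0 ≤ s := norm_nonneg _
    refine le_of_forall_gt_imp_ge_of_dense fun c hc => ?_
    have hc0 : 0 ≤ c := hs0.trans hc.le
    have h : ‖mk ω a‖ ≤ √c := by
      refine norm_mk_le_of_eventually ω a (Real.sqrt_nonneg c) ?_
      filter_upwards [eventually_norm_lt ω (star a * a) hc] with i hi
      refine Real.le_sqrt_of_sq_le ?_
      have : ‖(star a * a) i‖ = ‖a i‖ * ‖a i‖ := CStarRing.norm_star_mul_self (x := a i)
      rw [sq, ← this]
      exact hi.le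
    calc ‖mk ω a‖ * ‖mk ω a‖ ≤ √c * √c := by gcongr
      _ = c := Real.mul_self_sqrt hc0

instance : CStarAlgebra (Ultraproduct ω A) where

/-- The usual order on a C*-algebra: the nonnegative elements are the positive ones. -/
instance : PartialOrder (Ultraproduct ω A) := CStarAlgebra.spectralOrder _

instance : StarOrderedRing (Ultraproduct ω A) := CStarAlgebra.spectralOrderedRing _

variable {A} {B : ℕ → Type*} [∀ i, CStarAlgebra (B i)] [∀ i, Nontrivial (B i)]

/-- The map induced on bounded sequences by a sequence of *-homomorphisms. -/
def mapSeq (π : ∀ i, A i →⋆ₐ[ℂ] B i) : lp A ∞ →ₐ[ℂ] lp B ∞ :=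
  AlgHom.ofLinearMap
    { toFun := fun a => ⟨fun i => π i (a i), memℓp_infty ⟨‖a‖, by
        rintro _ ⟨i, rfl⟩
        exact (NonUnitalStarAlgHom.norm_apply_le (π i) (a i)).trans
          (lp.norm_apply_le_norm (by simp) a i)⟩⟩
      map_add' := fun a b => lp.ext (funext fun i => map_add (π i) (a i) (b i))
      map_smul' := fun c a => lp.ext (funext fun i => map_smul (π i) c (a i)) }
    (lp.ext (funext fun i => map_one (π i)))
    (fun a b => lp.ext (funext fun i => map_mul (π i) (a i) (b i)))

lemma mapSeq_apply (π : ∀ i, A i →⋆ₐ[ℂ] B i) (a : lp A ∞) (i : ℕ) :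
    mapSeq π a i = π i (a i) := rfl

/-- The *-homomorphism `π_ω` induced on ultraproducts by a sequence of *-homomorphisms `π_i`;
it sends the class of `(a_i)` to the class of `(π_i(a_i))`. -/
def map (π : ∀ i, A i →⋆ₐ[ℂ] B i) : Ultraproduct ω A →⋆ₐ[ℂ] Ultraproduct ω B where
  __ := Ideal.Quotient.liftₐ (nullIdeal ω A) ((mk ω).comp (mapSeq π)) fun a ha => by
    have h0 : mk ω (mapSeq π a) = mk ω 0 := by
      rw [mk_eq_mk, sub_zero, mem_nullIdeal]
      exact squeeze_zero (fun i => norm_nonneg _)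
        (fun i => NonUnitalStarAlgHom.norm_apply_le (π i) (a i)) ((mem_nullIdeal ω).1 ha)
    rw [AlgHom.comp_apply, h0, map_zero]
  map_star' x := by
    obtain ⟨a, rfl⟩ := mk_surjective ω x
    change mk ω (mapSeq π (star a)) = star (mk ω (mapSeq π a))
    rw [star_mk]
    congr 1
    exact lp.ext (funext fun i => map_star (π i) (a i))

lemma map_mk (π : ∀ i, A i →⋆ₐ[ℂ] B i) (a : lp A ∞) :
    map ω π (mk ω a) = mk ω (mapSeq π a) := rfl

end Ultraproduct

end Ultraproduct

/-! ### Order zero maps and cones -/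

/-- A completely positive map is order zero if it sends orthogonal positive elements to orthogonal
elements. -/
def IsOrderZero {A B : Type*} [NonUnitalCStarAlgebra A] [NonUnitalCStarAlgebra B]
    [PartialOrder A] [PartialOrder B] [StarOrderedRing A] [StarOrderedRing B]
    (φ : A →CP B) : Prop :=
  ∀ a b : A, 0 ≤ a → 0 ≤ b → a * b = 0 → φ a * φ b = 0

/-- The cone `C₀((0,1], D) = C₀(0,1] ⊗ D` over `D`. -/
abbrev Cone (D : Type*) [CStarAlgebra D] : Type _ := C₀(Set.Ioc (0 : ℝ) 1, D)

instance (D : Type*) [CStarAlgebra D] : NonUnitalCStarAlgebra (Cone D) where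

/-- The elementary tensor `id_{(0,1]} ⊗ d`, that is, the function `t ↦ t d`. -/
def idTensor {D : Type*} [CStarAlgebra D] (d : D) : Cone D where
  toFun t := (t : ℝ) • d
  continuous_toFun := by fun_prop
  zero_at_infty' := by
    have h : Filter.Tendsto (fun t : Set.Ioc (0 : ℝ) 1 => (t : ℝ))
        (Filter.cocompact (Set.Ioc (0 : ℝ) 1)) (nhds 0) := by
      rw [Metric.tendsto_nhds]
      intro ε hε
      have hK : IsCompact {t : Set.Ioc (0 : ℝ) 1 | ε ≤ (t : ℝ)} := by
        rw [Subtype.isCompact_iff]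
        have : (Subtype.val '' {t : Set.Ioc (0 : ℝ) 1 | ε ≤ (t : ℝ)}) = Set.Icc ε 1 := by
          ext x
          simp only [Set.mem_image, Set.mem_ofPred_eq, Subtype.exists, Set.mem_Ioc, Set.mem_Icc]
          constructor
          · rintro ⟨y, hy, h1, rfl⟩
            exact ⟨h1, hy.2⟩
          · rintro ⟨h1, h2⟩
            exact ⟨x, ⟨hε.trans_le h1, h2⟩, h1, rfl⟩
        rw [this]
        exact isCompact_Icc
      filter_upwards [hK.compl_mem_cocompact] with t ht
      have ht' : (t : ℝ) < ε := by simpa using ht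
      rw [dist_zero_right, Real.norm_of_nonneg t.2.1.le]
      exact ht'
    simpa using h.smul_const d

end

/-! If `π_ω(a) = 0`, then `a` lies in the kernel of `π_ω`, a proper closed ideal. Conversely let `c
= π_ω(a) ≠ 0`. Simplicity and pure infiniteness of the `B_i` give `s_i` with `s_i⋆ c_i⋆ c_i s_i`
near `1`, with norms bounded uniformly in `i` (`exists_conjugate_near_one`), so some `s⋆ c⋆ c s` is
invertible. Lifting through `π_ω`, the ideal generated by `a` contains some `x` with `π_ω(x) = 1`,
that is, the class of a sequence `1 + j_i` with `j_i ∈ J_i`. Stability moves the unit away from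
`j_i`: two conjugates of `1 + j_i`, by elements of norm at most `2`, sum to within `3/4` of `1`
(`IsStableCStar.exists_conjugates_near_one`). Hence the ideal contains an invertible element.
Uniform bounds are what let all these choices pass to the ultraproduct.

For (ii), fullness of `Φ` becomes injectivity of `π_ω ∘ Φ` by (i). A closed ideal of the cone over a
simple `D` is determined by an open subset of `(0,1]`, so injectivity can be tested on functions of
`id ⊗ 1`, hence on the spectrum of its image (`Cone.spectrum_eq_iff_injective`). -/

section Stable

open Filter Topology

/-! ### Stability: almost units with orthogonal copies -/

namespace IsStabilisation

variable {C E : Type*} [NonUnitalCStarAlgebra C] [NonUnitalCStarAlgebra E]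
  {e : ℕ → ℕ → C →ₗ[ℂ] E}

/-- The diagonal embedding `c ↦ ∑_{k < n} c ⊗ e_{kk}` as a *-homomorphism. -/
noncomputable def diagHom (h : IsStabilisation e) (n : ℕ) : C →⋆ₙₐ[ℂ] E where
  toFun c := ∑ k ∈ Finset.range n, e k k c
  map_smul' a c := by simp [Finset.smul_sum]
  map_zero' := by simp
  map_add' a b := by simp [Finset.sum_add_distrib]
  map_mul' a b := by
    simp only [Finset.sum_mul, Finset.mul_sum, h.mul]
    refine Finset.sum_congr rfl fun i hi => ?_
    rw [Finset.sum_ite_eq', if_pos hi]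
  map_star' a := by simp [h.star]

lemma diagHom_apply (h : IsStabilisation e) (n : ℕ) (c : C) :
    h.diagHom n c = ∑ k ∈ Finset.range n, e k k c := rfl

/-- The corner embedding `c ↦ c ⊗ e_{kk}` as a *-homomorphism. -/
noncomputable def cornerHom (h : IsStabilisation e) (k : ℕ) : C →⋆ₙₐ[ℂ] E where
  toFun c := e k k c
  map_smul' a c := by simp
  map_zero' := by simp
  map_add' a b := by simp
  map_mul' a b := by simp [h.mul]
  map_star' a := by simp [h.star]

/-- By the C*-identity this reduces to the corner embedding at `j`, a *-homomorphism and hence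
contractive. -/
lemma norm_apply_le (h : IsStabilisation e) (i j : ℕ) (c : C) : ‖e i j c‖ ≤ ‖c‖ := by
  have h1 : ‖Star.star (e i j c) * e i j c‖ ≤ ‖Star.star c * c‖ := by
    rw [h.star, h.mul, if_pos rfl]
    exact NonUnitalStarAlgHom.norm_apply_le (h.cornerHom j) _
  rw [CStarRing.norm_star_mul_self, CStarRing.norm_star_mul_self] at h1
  exact abs_le_of_sq_le_sq' (by nlinarith) (norm_nonneg _) |>.2

lemma continuous_apply (h : IsStabilisation e) (i j : ℕ) : Continuous (e i j) :=
  AddMonoidHomClass.continuous_of_bound (e i j) 1 fun c => by simpa using h.norm_apply_le i j c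

/-- A finite matrix has finitely many nonzero rows. Once `n` exceeds their indices, left
multiplication by the diagonal `u` multiplies each entry by `u`, so an approximate unit of `C`
suffices. -/
lemma tendsto_diagHom_mul [PartialOrder C] [StarOrderedRing C] (h : IsStabilisation e) {x : E}
    (hx : x ∈ Submodule.span ℂ {x : E | ∃ (i j : ℕ) (a : C), e i j a = x}) :
    ∃ N, ∀ n ≥ N, Tendsto (fun u => h.diagHom n u * x) (CStarAlgebra.approximateUnit C) (𝓝 x) := by
  induction hx using Submodule.span_induction with
  | mem x hx =>
    obtain ⟨i, j, a, rfl⟩ := hx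
    refine ⟨i + 1, fun n hn => ?_⟩
    have h1 : ∀ u, h.diagHom n u * e i j a = e i j (u * a) := fun u => by
      rw [diagHom_apply, Finset.sum_mul]
      simp only [h.mul]
      rw [Finset.sum_eq_single i (fun k _ hk => if_neg hk)
        (fun hi => absurd (Finset.mem_range.2 (by omega)) hi), if_pos rfl]
    simp only [h1]
    exact ((h.continuous_apply i j).tendsto a).comp
      ((CStarAlgebra.increasingApproximateUnit C).tendsto_mul_right a)
  | zero => exact ⟨0, fun n _ => by simp⟩
  | add x y _ _ hx hy =>
    obtain ⟨N, hN⟩ := hx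
    obtain ⟨M, hM⟩ := hy
    refine ⟨max N M, fun n hn => ?_⟩
    simpa only [mul_add] using
      (hN n (le_of_max_le_left hn)).add (hM n (le_of_max_le_right hn))
  | smul c x _ hx =>
    obtain ⟨N, hN⟩ := hx
    exact ⟨N, fun n hn => by simpa only [mul_smul_comm] using (hN n hn).const_smul c⟩

/-- In a stabilisation every element is almost fixed by some positive contraction `p` such that
`p ^ 2` is Murray-von Neumann equivalent to an element orthogonal to `p`. -/
lemma exists_orthogonal_copy (h : IsStabilisation e) (x : E) {ε : ℝ} (hε : 0 < ε) :
    ∃ (u : C) (n : ℕ) (w : E), IsSelfAdjoint u ∧ quasispectrum ℝ u ⊆ Set.Icc 0 1 ∧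
      ‖h.diagHom n u‖ ≤ 1 ∧ ‖w‖ ≤ 1 ∧
      h.diagHom n u * w = 0 ∧ Star.star w * w = h.diagHom n u * h.diagHom n u ∧
      ‖x - h.diagHom n u * x‖ < ε := by
  let := CStarAlgebra.spectralOrder C
  have := CStarAlgebra.spectralOrderedRing C
  obtain ⟨y, hy, hxy⟩ := Metric.mem_closure_iff.1 (h.dense x) (ε / 3) (by positivity)
  obtain ⟨n, hn⟩ := h.tendsto_diagHom_mul hy
  have hau := CStarAlgebra.increasingApproximateUnit C
  obtain ⟨u, hu, hu0, hu1⟩ := (((Metric.tendsto_nhds.1 (hn n le_rfl)) (ε / 3) (by positivity)).and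
    (hau.eventually_nonneg.and hau.eventually_norm)).exists
  have husa := IsSelfAdjoint.of_nonneg hu0
  have hd : ‖h.diagHom n u‖ ≤ 1 := (NonUnitalStarAlgHom.norm_apply_le _ u).trans hu1
  -- Shifting the rows by `n` puts the range of `w` in the block of rows `n, …, 2n - 1`, orthogonal
  -- to the diagonal of `u`.
  set w : E := ∑ k ∈ Finset.range n, e (n + k) k u with hw
  have hww : Star.star w * w = h.diagHom n u * h.diagHom n u := by
    rw [← map_mul, diagHom_apply, hw, star_sum, Finset.sum_mul]
    refine Finset.sum_congr rfl fun i hi => ?_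
    rw [Finset.mul_sum]
    simp only [h.star, h.mul, husa.star_eq, add_right_inj]
    rw [Finset.sum_ite_eq, if_pos hi]
  refine ⟨u, n, w, husa, fun t ht => ⟨quasispectrum_nonneg_of_nonneg u hu0 t ht, ?_⟩, hd, ?_, ?_,
    hww, ?_⟩
  · exact (le_abs_self t).trans ((NonUnitalIsometricContinuousFunctionalCalculus.norm_quasispectrum_le u ht husa).trans hu1)
  · have h1 : ‖Star.star w * w‖ ≤ 1 := by
      rw [hww]
      exact (norm_mul_le _ _).trans (mul_le_one₀ hd (norm_nonneg _) hd)
    rw [CStarRing.norm_star_mul_self] at h1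
    nlinarith [norm_nonneg w]
  · rw [diagHom_apply, hw, Finset.sum_mul]
    refine Finset.sum_eq_zero fun i hi => ?_
    rw [Finset.mul_sum]
    refine Finset.sum_eq_zero fun k _ => ?_
    rw [h.mul, if_neg]
    have := Finset.mem_range.1 hi
    omega
  · have h1 : x - h.diagHom n u * x =
        (x - y) - (h.diagHom n u * y - y) - h.diagHom n u * (x - y) := by
      rw [mul_sub]; abel
    rw [dist_eq_norm] at hxy hu
    have h2 : ‖h.diagHom n u * (x - y)‖ ≤ ‖x - y‖ :=
      (norm_mul_le _ _).trans (mul_le_of_le_one_left (norm_nonneg _) hd)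
    rw [h1]
    linarith [norm_sub_le ((x - y) - (h.diagHom n u * y - y)) (h.diagHom n u * (x - y)),
      norm_sub_le (x - y) (h.diagHom n u * y - y)]

end IsStabilisation

/-- If `J` is stable and maps to a unital C*-algebra `A`, then for every `j : J` the unit of `A`
is close to a sum of two conjugates of `1 + j` by elements of norm at most two. -/
lemma IsStableCStar.exists_conjugates_near_one {J A : Type*} [NonUnitalCStarAlgebra J]
    [CStarAlgebra A] [Nontrivial A] (hJ : IsStableCStar J) (ι : J →⋆ₙₐ[ℂ] A) (j : J) :
    ∃ p q : A, ‖p‖ ≤ 2 ∧ ‖q‖ ≤ 2 ∧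
      ‖star p * (1 + ι j) * p + star q * (1 + ι j) * q - 1‖ ≤ 3 / 4 := by
  obtain ⟨e, he⟩ := hJ
  obtain ⟨u, n, w, hu, hspec, hn1, hw1, hnw, hww, hj⟩ :=
    he.exists_orthogonal_copy j (ε := 1 / 16) (by norm_num)
  set P : A := ι (he.diagHom n u) with hP
  set W : A := ι w with hW
  have hPn : ‖P‖ ≤ 1 := (NonUnitalStarAlgHom.norm_apply_le ι _).trans hn1
  have hWn : ‖W‖ ≤ 1 := (NonUnitalStarAlgHom.norm_apply_le ι _).trans hw1
  have hPsa : star P = P := by rw [hP, ← map_star, ← map_star, hu.star_eq]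
  have hPW : P * W = 0 := by rw [hP, hW, ← map_mul, hnw, map_zero]
  have hWP : star W * P = 0 := by
    have := congrArg star hPW
    rwa [star_mul, hPsa, star_zero] at this
  have hWW : star W * W = P * P := by rw [hP, hW, ← map_star, ← map_mul, hww, map_mul]
  have hJ' : ‖ι j - P * ι j‖ ≤ 1 / 16 := by
    rw [hP, ← map_mul, ← map_sub]
    exact (NonUnitalStarAlgHom.norm_apply_le ι _).trans hj.le
  -- `P` need not be a projection; its defect is controlled by `t - t² ≤ 1/4` on `[0,1]`.
  have hquad : ‖P - P * P‖ ≤ 1 / 4 := by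
    rw [hP, ← map_mul, ← map_mul, ← map_sub, ← map_sub]
    refine (NonUnitalStarAlgHom.norm_apply_le ι _).trans
      ((NonUnitalStarAlgHom.norm_apply_le (he.diagHom n) _).trans ?_)
    have h1 : u - u * u = cfcₙ (fun t : ℝ => t - t * t) u := by
      rw [cfcₙ_sub (fun t : ℝ => t) (fun t => t * t) u, cfcₙ_mul (fun t : ℝ => t) (fun t => t) u,
        cfcₙ_id' ℝ u]
    rw [h1]
    refine norm_cfcₙ_le fun t ht => ?_
    obtain ⟨h0, h1⟩ := hspec ht
    rw [Real.norm_eq_abs, abs_le]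
    constructor <;> nlinarith [sq_nonneg (t - 1 / 2)]
  have h1P : ‖1 - P‖ ≤ 2 := (norm_sub_le _ _).trans (by rw [norm_one]; linarith)
  -- Conjugation by `1 - P` nearly kills `ι j` but loses part of the unit. Since `W⋆W = P²` and `W⋆P
  -- = 0`, conjugation by `W` restores `P²` and also nearly kills `ι j`. What remains is `-2(P -
  -- P²)` plus two small terms, in all at most `1/2 + 1/8 + 1/16 < 3/4`.
  refine ⟨1 - P, W, h1P, by linarith, ?_⟩
  have hWj : star W * ι j = star W * (ι j - P * ι j) := by
    rw [mul_sub, ← mul_assoc, hWP, zero_mul, sub_zero]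
  have key : star (1 - P) * (1 + ι j) * (1 - P) + star W * (1 + ι j) * W - 1 =
      (ι j - P * ι j) * (1 - P) + star W * (ι j - P * ι j) * W - (P - P * P) - (P - P * P) := by
    have e1 : star W * (1 + ι j) * W = P * P + star W * (ι j - P * ι j) * W := by
      rw [mul_add, mul_one, add_mul, hWW, hWj]
    rw [e1, star_sub, star_one, hPsa]
    noncomm_ring
  have n1 : ‖(ι j - P * ι j) * (1 - P)‖ ≤ 1 / 16 * 2 := (norm_mul_le _ _).trans (by gcongr)
  have n2 : ‖star W * (ι j - P * ι j) * W‖ ≤ 1 * (1 / 16) * 1 := by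
    refine (norm_mul_le _ _).trans ?_
    gcongr
    refine (norm_mul_le _ _).trans ?_
    rw [norm_star]
    gcongr
  rw [key]
  linarith [norm_sub_le ((ι j - P * ι j) * (1 - P) + star W * (ι j - P * ι j) * W - (P - P * P))
    (P - P * P), norm_sub_le ((ι j - P * ι j) * (1 - P) + star W * (ι j - P * ι j) * W) (P - P * P),
    norm_add_le ((ι j - P * ι j) * (1 - P)) (star W * (ι j - P * ι j) * W)]

end Stable

/-! ### Norm-preserving lifts -/

section Lift

lemma cfc_mul_self_mul_cfc {A : Type*} [CStarAlgebra A] {f : ℝ → ℝ} (hf : Continuous f) {a : A}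
    (ha : IsSelfAdjoint a) : cfc f a * a * cfc f a = cfc (fun t => f t * t * f t) a := by
  have h1 : ContinuousOn f (spectrum ℝ a) := hf.continuousOn
  have h2 : ContinuousOn (fun t => f t * t) (spectrum ℝ a) := h1.mul continuousOn_id
  rw [cfc_mul (fun t => f t * t) f a h2 h1, cfc_mul f (fun t => t) a h1 continuousOn_id,
    cfc_id' ℝ a]

/-- A surjective *-homomorphism of C*-algebras admits norm-preserving lifts of elements. -/
lemma exists_lift_norm_le {A B : Type*} [CStarAlgebra A] [CStarAlgebra B] (π : A →⋆ₐ[ℂ] B)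
    (hπ : Function.Surjective π) (b : B) : ∃ a : A, π a = b ∧ ‖a‖ ≤ ‖b‖ := by
  rcases eq_or_ne b 0 with rfl | hb
  · exact ⟨0, by simp⟩
  have hc : 0 < ‖b‖ := norm_pos_iff.2 hb
  set c := ‖b‖
  obtain ⟨a, ha⟩ := hπ b
  -- Multiplying `a` by `f(a⋆a)` cuts `|a|` down to `min(|a|, c)`. The factor is `1` on `[0, c²]`,
  -- which contains the spectrum of `b⋆b`, so the image in `B` is unchanged.
  let f : ℝ → ℝ := fun t => c / max c √|t|
  have hf : Continuous f := by
    refine continuous_const.div (by fun_prop) fun t => (lt_max_of_lt_left hc).ne'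
  have hsa : IsSelfAdjoint (star a * a) := .star_mul_self a
  set k := cfc f (star a * a) with hk
  have hksa : star k = k := (cfc_predicate f (star a * a) : IsSelfAdjoint k).star_eq
  refine ⟨a * k, ?_, ?_⟩
  · have h1 : π k = 1 := by
      have h2 : π k = cfc f (π (star a * a)) :=
        StarAlgHomClass.map_cfc (S := ℂ) π f (star a * a) hf.continuousOn
          (AddMonoidHomClass.continuous_of_bound π 1 fun x => by
            simpa using NonUnitalStarAlgHom.norm_apply_le π x) hsa (hsa.map π)
      rw [h2, map_mul, map_star, ha, ← cfc_const_one ℝ (star b * b)]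
      refine cfc_congr fun t ht => ?_
      have : Nontrivial B := ⟨b, 0, hb⟩
      have h3 := spectrum.norm_le_norm_of_mem ht
      rw [CStarRing.norm_star_mul_self] at h3
      have h4 : √|t| ≤ c := Real.sqrt_le_iff.2 ⟨hc.le, by rw [sq]; exact h3⟩
      simp only [f, max_eq_left h4, div_self hc.ne']
    rw [map_mul, h1, ha, mul_one]
  · have h1 : star (a * k) * (a * k) = cfc (fun t => f t * t * f t) (star a * a) := by
      rw [← cfc_mul_self_mul_cfc hf hsa, ← hk, star_mul, hksa]
      noncomm_ring
    have h2 : ‖star (a * k) * (a * k)‖ ≤ c ^ 2 := by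
      rw [h1]
      refine norm_cfc_le (by positivity) fun t _ => ?_
      have hm : 0 < max c √|t| := lt_max_of_lt_left hc
      have h5 : |t| ≤ (max c √|t|) ^ 2 := by
        calc |t| = √|t| ^ 2 := (Real.sq_sqrt (abs_nonneg t)).symm
          _ ≤ _ := by gcongr; exact le_max_right _ _
      have h6 : 0 ≤ f t := by positivity
      rw [Real.norm_eq_abs, abs_mul, abs_mul, abs_of_nonneg h6]
      simp only [f]
      rw [show c / max c √|t| * |t| * (c / max c √|t|) = c ^ 2 * (|t| / (max c √|t|) ^ 2) by
        field_simp]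
      exact mul_le_of_le_one_right (by positivity) ((div_le_one (by positivity)).2 h5)
    rw [CStarRing.norm_star_mul_self, ← sq] at h2
    exact abs_le_of_sq_le_sq' h2 hc.le |>.2

end Lift

/-! ### Norm control in pure infiniteness -/

section PurelyInfinite

/-- In a simple purely infinite C*-algebra, every positive element of norm greater than `δ` can be
conjugated close to the unit by an element whose norm is controlled by `δ`. -/
lemma exists_conjugate_near_one {B : Type*} [CStarAlgebra B] [Nontrivial B] [PartialOrder B]
    [StarOrderedRing B] (hs : IsSimpleCStar B) (hp : IsPurelyInfinite B) {b : B} (hb : 0 ≤ b)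
    {δ : ℝ} (hδ : 0 < δ) (hbδ : δ < ‖b‖) :
    ∃ s : B, ‖s‖ ^ 2 ≤ 3 / 2 / δ ∧ ‖star s * b * s - 1‖ ≤ 1 / 2 := by
  have hbsa := IsSelfAdjoint.of_nonneg hb
  let g : ℝ → ℝ := fun t => max 0 (t - δ)
  -- Pure infiniteness gives no bound on `r`, so it is applied to the cut-down `g(b) = (b - δ)₊`. As
  -- `k² t = g` and `k² ≤ g/δ`, the element `s = k(b) r` satisfies `s⋆ b s = r⋆ g(b) r` and `s⋆ s ≤
  -- δ⁻¹ r⋆ g(b) r`, whose norm is at most `(3/2)/δ`.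
  let k : ℝ → ℝ := fun t => √(g t / max δ t)
  have hg : Continuous g := by fun_prop
  have hk : Continuous k :=
    (hg.div (by fun_prop) fun t => (lt_max_of_lt_left hδ).ne').sqrt
  have hg0 : ∀ t, 0 ≤ g t := fun t => le_max_left _ _
  have hkk : ∀ t, k t * k t = g t / max δ t := fun t =>
    Real.mul_self_sqrt (div_nonneg (hg0 t) (lt_max_of_lt_left hδ).le)
  have hktk : ∀ t, k t * t * k t = g t := fun t => by
    rw [mul_right_comm, hkk]
    rcases le_total t δ with h | h
    · simp [g, h]
    · rw [max_eq_right h, div_mul_cancel₀ _ (hδ.trans_le h).ne']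
  have hgb : cfc g b ≠ 0 := fun h0 => by
    have h1 := norm_apply_le_norm_cfc g b (CStarAlgebra.norm_mem_spectrum_of_nonneg hb)
      hg.continuousOn
    rw [h0, norm_zero, Real.norm_eq_abs, abs_of_nonneg (hg0 _)] at h1
    have : ‖b‖ - δ ≤ g ‖b‖ := le_max_right _ _
    linarith
  have hmem : MemClosedIdealSpan (cfc g b) (1 : B) := fun I hI hgI => by
    rcases hs.2 I hI with rfl | rfl
    · exact absurd ((TwoSidedIdeal.mem_bot B).1 hgI) hgb
    · trivial
  obtain ⟨r, hr⟩ := hp.2 _ _ (cfc_nonneg fun t _ => hg0 t) zero_le_one hmem (1 / 2) (by norm_num)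
  have hksa : star (cfc k b) = cfc k b := (cfc_predicate k b : IsSelfAdjoint _).star_eq
  have hconj : cfc k b * b * cfc k b = cfc g b := by
    rw [← cfc_congr (f := fun t => k t * t * k t) (g := g) fun t _ => hktk t,
      cfc_mul_self_mul_cfc hk hbsa]
  refine ⟨cfc k b * r, ?_, ?_⟩
  · have h1 : cfc k b * cfc k b ≤ δ⁻¹ • cfc g b := by
      rw [← cfc_mul k k b hk.continuousOn hk.continuousOn, ← cfc_smul δ⁻¹ g b hg.continuousOn]
      refine cfc_mono (fun t _ => ?_) (hk.mul hk).continuousOn (hg.const_smul δ⁻¹).continuousOn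
      rw [hkk, smul_eq_mul, div_eq_inv_mul]
      exact mul_le_mul_of_nonneg_right (inv_anti₀ hδ (le_max_left _ _)) (hg0 t)
    have h2 : star (cfc k b * r) * (cfc k b * r) ≤ δ⁻¹ • (star r * cfc g b * r) := by
      have h3 := star_left_conjugate_le_conjugate h1 r
      rw [mul_smul_comm, smul_mul_assoc] at h3
      rwa [star_mul, hksa, show star r * cfc k b * (cfc k b * r) =
        star r * (cfc k b * cfc k b) * r by noncomm_ring]
    have h4 := CStarAlgebra.norm_le_norm_of_nonneg_of_le (star_mul_self_nonneg _) h2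
    have h5 : ‖star r * cfc g b * r‖ ≤ 3 / 2 := by
      have := norm_add_le (star r * cfc g b * r - 1) 1
      rw [sub_add_cancel, norm_one] at this
      linarith
    rw [CStarRing.norm_star_mul_self, norm_smul, Real.norm_of_nonneg (inv_pos.2 hδ).le] at h4
    calc ‖cfc k b * r‖ ^ 2 ≤ δ⁻¹ * ‖star r * cfc g b * r‖ := by rw [sq]; exact h4
      _ ≤ δ⁻¹ * (3 / 2) := by gcongr
      _ = _ := by ring
  · rw [star_mul, hksa, show star r * cfc k b * b * (cfc k b * r) =
      star r * (cfc k b * b * cfc k b) * r by noncomm_ring, hconj]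
    exact hr.le

end PurelyInfinite

/-! ### Full elements of the ultraproduct -/

section UltraproductFullness

open Filter Topology

namespace Ultraproduct

/-- Solutions found at almost every index assemble into an element of `lp A ∞` because of the common
bound `C`; the value `0` fills the other indices. -/
lemma exists_bounded_seq (ω : Ultrafilter ℕ) {A : ℕ → Type*} [∀ i, CStarAlgebra (A i)]
    {C : ℝ} (hC : 0 ≤ C) {P : ∀ i, A i → Prop}
    (h : ∀ᶠ i in ω, ∃ a : A i, ‖a‖ ≤ C ∧ P i a) :
    ∃ a : lp A ∞, ∀ᶠ i in ω, P i (a i) := by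
  classical
  let s : ∀ i, A i := fun i => if hi : ∃ a : A i, ‖a‖ ≤ C ∧ P i a then hi.choose else 0
  have hs : ∀ i, ‖s i‖ ≤ C := fun i => by
    simp only [s]
    split_ifs with hi
    · exact hi.choose_spec.1
    · simpa using hC
  refine ⟨⟨s, memℓp_infty ⟨C, by rintro _ ⟨i, rfl⟩; exact hs i⟩⟩, ?_⟩
  filter_upwards [h] with i hi
  simp only [s, dif_pos hi]
  exact hi.choose_spec.2

variable (ω : Ultrafilter ℕ) {A B J : ℕ → Type*} [∀ i, CStarAlgebra (A i)] [∀ i, Nontrivial (A i)]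
  [∀ i, CStarAlgebra (B i)] [∀ i, Nontrivial (B i)]

lemma map_surjective {π : ∀ i, A i →⋆ₐ[ℂ] B i} (hπ : ∀ i, Function.Surjective (π i)) :
    Function.Surjective (map ω π) := fun x => by
  obtain ⟨b, rfl⟩ := mk_surjective ω x
  choose a ha hab using fun i => exists_lift_norm_le (π i) (hπ i) (b i)
  refine ⟨mk ω ⟨a, memℓp_infty ⟨‖b‖, by
    rintro _ ⟨i, rfl⟩
    exact (hab i).trans (lp.norm_apply_le_norm (by simp) b i)⟩⟩, ?_⟩
  rw [map_mk]
  exact congrArg (mk ω) (lp.ext (funext ha))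

/-- Every element in the kernel of the induced map is the class of a bounded sequence of elements
of the kernels. -/
lemma exists_seq_of_map_eq_zero {π : ∀ i, A i →⋆ₐ[ℂ] B i}
    (hπ : ∀ i, Function.Surjective (π i)) {x : Ultraproduct ω A} (hx : map ω π x = 0) :
    ∃ a : lp A ∞, mk ω a = x ∧ ∀ i, π i (a i) = 0 := by
  obtain ⟨b, rfl⟩ := mk_surjective ω x
  have hb : Tendsto (fun i => ‖π i (b i)‖) ω (𝓝 0) := by
    rw [map_mk, ← map_zero (mk ω), mk_eq_mk, sub_zero] at hx
    exact hx
  -- Subtracting lifts of `π i (b i)` lands in the kernels; as the lifts preserve norms, they form a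
  -- null sequence and the class is unchanged.
  choose c hc hcb using fun i => exists_lift_norm_le (π i) (hπ i) (π i (b i))
  let c' : lp A ∞ := ⟨c, memℓp_infty ⟨‖b‖, by
    rintro _ ⟨i, rfl⟩
    exact (hcb i).trans ((NonUnitalStarAlgHom.norm_apply_le (π i) (b i)).trans
      (lp.norm_apply_le_norm (by simp) b i))⟩⟩
  refine ⟨b - c', ?_, fun i => ?_⟩
  · rw [mk_eq_mk, sub_sub_cancel_left, neg_mem_iff, mem_nullIdeal]
    exact squeeze_zero (fun i => norm_nonneg _) hcb hb
  · change π i (b i - c i) = 0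
    rw [map_sub, hc, sub_self]

lemma eq_top_of_norm_sub_one_lt {R : Type*} [NormedRing R] [CompleteSpace R] {I : TwoSidedIdeal R}
    {x : R} (hx : x ∈ I) (h : ‖x - 1‖ < 1) (y : R) : y ∈ I := by
  have hu : IsUnit x := by
    have h1 : ‖1 - x‖ < 1 := by rwa [norm_sub_rev]
    simpa using (Units.oneSub (1 - x) h1).isUnit
  obtain ⟨u, rfl⟩ := hu
  simpa using I.mul_mem_right _ y (I.mul_mem_right _ (↑u⁻¹ : R) hx)

/-- If the kernels are stable, then a closed ideal containing a lift of the unit is everything. -/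
lemma mem_of_map_eq_one [∀ i, NonUnitalCStarAlgebra (J i)] {ι : ∀ i, J i →⋆ₙₐ[ℂ] A i}
    {π : ∀ i, A i →⋆ₐ[ℂ] B i} (hext : ∀ i, IsUnitalExtension (ι i) (π i))
    (hJ : ∀ i, IsStableCStar (J i)) {I : TwoSidedIdeal (Ultraproduct ω A)} {x : Ultraproduct ω A}
    (hxI : x ∈ I) (hx : map ω π x = 1) (y : Ultraproduct ω A) : y ∈ I := by
  obtain ⟨a, ha, ha0⟩ := exists_seq_of_map_eq_zero ω (fun i => (hext i).surjective)
    (x := x - 1) (by rw [map_sub, hx, map_one, sub_self])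
  have hxa : x = mk ω (1 + a) := by rw [map_add, map_one, ha]; abel
  have hpq : ∀ i, ∃ p q : A i, ‖p‖ ≤ 2 ∧ ‖q‖ ≤ 2 ∧
      ‖star p * (1 + a i) * p + star q * (1 + a i) * q - 1‖ ≤ 3 / 4 := fun i => by
    obtain ⟨j, hj⟩ := ((hext i).exact (a i)).1 (ha0 i)
    rw [← hj]
    exact (hJ i).exists_conjugates_near_one (ι i) j
  choose p q hp hq hpq using hpq
  let p' : lp A ∞ := ⟨p, memℓp_infty ⟨2, by rintro _ ⟨i, rfl⟩; exact hp i⟩⟩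
  let q' : lp A ∞ := ⟨q, memℓp_infty ⟨2, by rintro _ ⟨i, rfl⟩; exact hq i⟩⟩
  have hn : ‖mk ω (star p' * (1 + a) * p' + star q' * (1 + a) * q' - 1)‖ ≤ 3 / 4 :=
    norm_mk_le_of_eventually ω _ (by norm_num) (.of_forall hpq)
  refine eq_top_of_norm_sub_one_lt
    (x := mk ω (star p') * x * mk ω p' + mk ω (star q') * x * mk ω q') ?_ ?_ y
  · exact I.add_mem (I.mul_mem_right _ _ (I.mul_mem_left _ _ hxI))
      (I.mul_mem_right _ _ (I.mul_mem_left _ _ hxI))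
  · rw [hxa]
    simp only [← map_mul, ← map_add]
    rw [← map_one (mk ω), ← map_sub]
    exact hn.trans_lt (by norm_num)

/-- In an ultraproduct of simple purely infinite C*-algebras, every nonzero `c` admits some `s` with
`s⋆ c⋆ c s` invertible. -/
lemma exists_conjugate_isUnit [∀ i, PartialOrder (B i)] [∀ i, StarOrderedRing (B i)]
    (hs : ∀ i, IsSimpleCStar (B i)) (hp : ∀ i, IsPurelyInfinite (B i)) {c : Ultraproduct ω B}
    (hc : c ≠ 0) : ∃ s : Ultraproduct ω B, IsUnit (star s * (star c * c) * s) := by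
  obtain ⟨b, rfl⟩ := mk_surjective ω c
  set γ := ‖mk ω b‖ with hγ
  have hγ0 : 0 < γ := norm_pos_iff.2 hc
  have hbig : ∀ᶠ i in ω, γ / 2 < ‖b i‖ := by
    -- For an ultrafilter, failing to hold almost everywhere means that the negation holds almost
    -- everywhere.
    have h : ¬ ∀ᶠ i in ω, ‖b i‖ ≤ γ / 2 := fun h => by
      have := norm_mk_le_of_eventually ω b (by positivity) h
      linarith
    simpa using Ultrafilter.eventually_not.2 h
  set δ := (γ / 2) ^ 2 with hδ
  have hδ0 : 0 < δ := by positivity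
  obtain ⟨s, hs⟩ := exists_bounded_seq ω (A := B) (C := √(3 / 2 / δ)) (Real.sqrt_nonneg _)
    (P := fun i s => ‖star s * (star (b i) * b i) * s - 1‖ ≤ 1 / 2) (by
      filter_upwards [hbig] with i hi
      obtain ⟨s, hs1, hs2⟩ := exists_conjugate_near_one (hs i) (hp i)
        (star_mul_self_nonneg (b i)) hδ0 (by
          rw [CStarRing.norm_star_mul_self, hδ, sq]
          gcongr)
      exact ⟨s, Real.le_sqrt_of_sq_le hs1, hs2⟩)
  refine ⟨mk ω s, ?_⟩
  have hn : ‖mk ω (star s * (star b * b) * s - 1)‖ ≤ 1 / 2 :=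
    norm_mk_le_of_eventually ω _ (by norm_num) hs
  simp only [star_mk, ← map_mul]
  rw [map_sub, map_one] at hn
  have h1 : ‖1 - mk ω (star s * (star b * b) * s)‖ < 1 := by
    rw [norm_sub_rev]
    linarith
  simpa using (Units.oneSub _ h1).isUnit

instance : Nontrivial (Ultraproduct ω A) := by
  refine ⟨1, 0, fun h => ?_⟩
  have h1 : ‖mk ω (1 : lp A ∞)‖ < 1 := by rw [map_one, h, norm_zero]; exact one_pos
  obtain ⟨i, hi⟩ := (eventually_norm_lt ω _ h1).exists
  have h2 : ((1 : lp A ∞) i) = 1 := rfl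
  rw [h2, norm_one] at hi
  exact lt_irrefl _ hi

lemma isFullElement_iff_map_ne_zero [∀ i, NonUnitalCStarAlgebra (J i)]
    [∀ i, PartialOrder (B i)] [∀ i, StarOrderedRing (B i)]
    {ι : ∀ i, J i →⋆ₙₐ[ℂ] A i} {π : ∀ i, A i →⋆ₐ[ℂ] B i}
    (hext : ∀ i, IsUnitalExtension (ι i) (π i)) (hs : ∀ i, IsSimpleCStar (B i))
    (hp : ∀ i, IsPurelyInfinite (B i)) (hJ : ∀ i, IsStableCStar (J i)) (a : Ultraproduct ω A) :
    IsFullElement a ↔ map ω π a ≠ 0 := by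
  constructor
  · intro h h0
    have hcont : Continuous (map ω π) :=
      AddMonoidHomClass.continuous_of_bound (map ω π) 1 fun x => by
        simpa using NonUnitalStarAlgHom.norm_apply_le (map ω π) x
    have hmem := h 1 (TwoSidedIdeal.ker (map ω π)) (by
      have : (TwoSidedIdeal.ker (map ω π) : Set (Ultraproduct ω A)) = map ω π ⁻¹' {0} := by
        ext x
        simp [TwoSidedIdeal.mem_ker]
      rw [this]
      exact isClosed_singleton.preimage hcont) ((TwoSidedIdeal.mem_ker _).2 h0)
    rw [TwoSidedIdeal.mem_ker, map_one] at hmem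
    exact one_ne_zero hmem
  · intro h0 y I _ haI
    obtain ⟨s, hu⟩ := exists_conjugate_isUnit ω hs hp h0
    obtain ⟨v, hv⟩ := hu.exists_right_inv
    have hsurj := map_surjective ω fun i => (hext i).surjective
    obtain ⟨s, rfl⟩ := hsurj s
    obtain ⟨v, rfl⟩ := hsurj v
    -- `s` and `v` now denote lifts, so this element of the ideal maps to an invertible element
    -- times its inverse.
    refine mem_of_map_eq_one ω hext hJ (x := star s * (star a * a) * s * v) ?_ ?_ y
    · exact I.mul_mem_right _ _ (I.mul_mem_right _ _ (I.mul_mem_left _ _ (I.mul_mem_left _ _ haI)))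
    · simpa only [map_mul, map_star] using hv

end Ultraproduct

end UltraproductFullness

/-! ### Injectivity on cones and the spectrum of `id ⊗ 1` -/

namespace Cone

variable {D C : Type*} [CStarAlgebra D] [CStarAlgebra C]

/-- Evaluation at a point of `(0,1]`, as a *-homomorphism. -/
noncomputable def evalHom (t : Set.Ioc (0 : ℝ) 1) : Cone D →⋆ₙₐ[ℂ] D where
  toFun f := f t
  map_smul' _ _ := rfl
  map_zero' := rfl
  map_add' _ _ := rfl
  map_mul' _ _ := rfl
  map_star' _ := rfl

lemma evalHom_apply (t : Set.Ioc (0 : ℝ) 1) (f : Cone D) : evalHom t f = f t := rfl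

lemma idTensor_apply (d : D) (t : Set.Ioc (0 : ℝ) 1) : idTensor d t = (t : ℝ) • d := rfl

lemma norm_le {f : Cone D} {c : ℝ} (hc : 0 ≤ c) (h : ∀ t, ‖f t‖ ≤ c) : ‖f‖ ≤ c :=
  (BoundedContinuousFunction.norm_le hc).2 h

lemma isSelfAdjoint_idTensor_one : IsSelfAdjoint (idTensor (1 : D)) := by
  refine DFunLike.ext _ _ fun t => ?_
  change star ((t : ℝ) • (1 : D)) = (t : ℝ) • (1 : D)
  simp

lemma map_cfcₙ_idTensor {A : Type*} [CStarAlgebra A] (ψ : Cone D →⋆ₙₐ[ℂ] A) {f : ℝ → ℝ}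
    (hf : Continuous f) (hf0 : f 0 = 0) :
    ψ (cfcₙ f (idTensor (1 : D))) = cfc f (ψ (idTensor 1)) := by
  rw [← cfcₙ_eq_cfc hf.continuousOn hf0]
  exact NonUnitalStarAlgHomClass.map_cfcₙ (S := ℂ) ψ f (idTensor 1) hf.continuousOn hf0
    (AddMonoidHomClass.continuous_of_bound ψ 1 fun x => by
      simpa using NonUnitalStarAlgHom.norm_apply_le ψ x)
    isSelfAdjoint_idTensor_one (isSelfAdjoint_idTensor_one.map ψ)

/-- Evaluation at `t` is a *-homomorphism, so it commutes with functional calculus, and it sends `id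
⊗ 1` to the scalar `t`. -/
lemma cfcₙ_idTensor_apply {f : ℝ → ℝ} (hf : Continuous f) (hf0 : f 0 = 0)
    (t : Set.Ioc (0 : ℝ) 1) : cfcₙ f (idTensor (1 : D)) t = f t • (1 : D) := by
  rw [← evalHom_apply, map_cfcₙ_idTensor (evalHom t) hf hf0, evalHom_apply, idTensor_apply,
    ← Algebra.algebraMap_eq_smul_one, cfc_algebraMap, Algebra.algebraMap_eq_smul_one]

lemma spectrum_map_idTensor_subset (ψ : Cone D →⋆ₙₐ[ℂ] C) :
    spectrum ℝ (ψ (idTensor 1)) ⊆ Set.Icc 0 1 := fun x hx => by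
  -- `f` vanishes exactly on `[0,1]`, so `f(id ⊗ 1) = 0` in the cone, which forces `f` to vanish on
  -- the spectrum of the image.
  let f : ℝ → ℝ := fun t => max 0 (-t) + max 0 (t - 1)
  have hf : Continuous f := by fun_prop
  have hf0 : f 0 = 0 := by simp [f]
  have hE : cfcₙ f (idTensor (1 : D)) = 0 := by
    refine DFunLike.ext _ _ fun t => ?_
    have : f t = 0 := by simp [f, t.2.1.le, t.2.2]
    rw [cfcₙ_idTensor_apply hf hf0, this, zero_smul]
    rfl
  have h := norm_apply_le_norm_cfc f (ψ (idTensor 1)) hx hf.continuousOn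
    (isSelfAdjoint_idTensor_one.map ψ)
  rw [← map_cfcₙ_idTensor ψ hf hf0, hE, map_zero, norm_zero, norm_le_zero_iff] at h
  have h1 := le_max_left 0 (-x)
  have h2 := le_max_left 0 (x - 1)
  have h3 := le_max_right 0 (-x)
  have h4 := le_max_right 0 (x - 1)
  have h5 : max 0 (-x) + max 0 (x - 1) = 0 := h
  constructor <;> linarith

/-- The tent function of height one and width `2δ` at `t`. -/
noncomputable def tent (t δ x : ℝ) : ℝ := max 0 (1 - |x - t| / δ)

lemma continuous_tent (t δ : ℝ) : Continuous (tent t δ) := by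
  unfold tent
  fun_prop

lemma tent_self (t δ : ℝ) : tent t δ t = 1 := by simp [tent]

lemma tent_of_le {t δ x : ℝ} (hδ : 0 < δ) (h : δ ≤ |x - t|) : tent t δ x = 0 :=
  max_eq_left (sub_nonpos.2 ((one_le_div hδ).2 h))

lemma tent_nonneg (t δ x : ℝ) : 0 ≤ tent t δ x := le_max_left _ _

lemma tent_le_one {t δ : ℝ} (hδ : 0 < δ) (x : ℝ) : tent t δ x ≤ 1 :=
  max_le zero_le_one (sub_le_self _ (by positivity))

lemma tent_zero {t δ : ℝ} (hδ : 0 < δ) (h : δ ≤ t) : tent t δ 0 = 0 :=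
  tent_of_le hδ (by simpa using h.trans (le_abs_self t))

/-- A gap in the spectrum around some `t ∈ (0,1]` would support a tent function giving a nonzero
element killed by `ψ`. The point `0` follows since the spectrum is closed. -/
lemma spectrum_map_idTensor_of_injective [Nontrivial D] {ψ : Cone D →⋆ₙₐ[ℂ] C}
    (hψ : Function.Injective ψ) : spectrum ℝ (ψ (idTensor 1)) = Set.Icc 0 1 := by
  refine (spectrum_map_idTensor_subset ψ).antisymm ?_
  have hclosed : IsClosed (spectrum ℝ (ψ (idTensor (1 : D)))) := spectrum.isClosed _
  rw [← closure_Ioc (zero_ne_one' ℝ)]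
  refine hclosed.closure_subset_iff.2 fun t ht => ?_
  by_contra hts
  obtain ⟨ε, hε, hball⟩ := Metric.isOpen_iff.1 hclosed.isOpen_compl t hts
  -- Width at most `t` makes the tent vanish at `0`, as the non-unital calculus requires.
  have hδ : 0 < min ε t := lt_min hε ht.1
  have hf := continuous_tent t (min ε t)
  have hf0 := tent_zero hδ (min_le_right ε t)
  have h0 : ψ (cfcₙ (tent t (min ε t)) (idTensor (1 : D))) = 0 := by
    rw [map_cfcₙ_idTensor ψ hf hf0, ← cfc_const_zero ℝ (ψ (idTensor (1 : D)))]
    refine cfc_congr fun x hx => tent_of_le hδ ?_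
    by_contra! hlt
    exact hball (Metric.mem_ball.2 (hlt.trans_le (min_le_left _ _))) hx
  have h1 := congrArg (fun F : Cone D => F ⟨t, ht⟩) ((map_eq_zero_iff ψ hψ).1 h0)
  simp only [cfcₙ_idTensor_apply hf hf0, tent_self, one_smul] at h1
  exact one_ne_zero h1

/-- The closure of the set of values at `t` of the elements of the kernel of `ψ`. -/
noncomputable def kerValues (ψ : Cone D →⋆ₙₐ[ℂ] C) (t : Set.Ioc (0 : ℝ) 1) : TwoSidedIdeal D :=
  have hmul : ∀ x : D, idTensor ((t : ℝ)⁻¹ • x) t = x := fun x => by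
    rw [idTensor_apply, smul_smul, mul_inv_cancel₀ t.2.1.ne', one_smul]
  TwoSidedIdeal.mk' (closure (evalHom t '' {g : Cone D | ψ g = 0}))
    (subset_closure ⟨0, map_zero ψ, rfl⟩)
    (fun hx hy => map_mem_closure₂ continuous_add hx hy (by
      rintro _ ⟨g, hg, rfl⟩ _ ⟨k, hk, rfl⟩
      exact ⟨g + k, by simp_all [map_add], rfl⟩))
    (fun hx => map_mem_closure continuous_neg hx (by
      rintro _ ⟨g, hg, rfl⟩
      exact ⟨-g, by simp_all [map_neg], rfl⟩))
    (fun {x _} hy => map_mem_closure (continuous_const_mul x) hy (by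
      rintro _ ⟨g, hg, rfl⟩
      refine ⟨idTensor ((t : ℝ)⁻¹ • x) * g, by simp_all [map_mul], ?_⟩
      rw [map_mul, evalHom_apply, hmul]))
    (fun {_} {y} hx => map_mem_closure (f := fun x => x * y) (continuous_mul_const y) hx (by
      rintro _ ⟨g, hg, rfl⟩
      refine ⟨g * idTensor ((t : ℝ)⁻¹ • y), by simp_all [map_mul], ?_⟩
      rw [map_mul, evalHom_apply t (idTensor _), hmul]))

lemma coe_kerValues (ψ : Cone D →⋆ₙₐ[ℂ] C) (t : Set.Ioc (0 : ℝ) 1) :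
    (kerValues ψ t : Set D) = closure (evalHom t '' {g : Cone D | ψ g = 0}) := by
  simp [kerValues]

/-- If the kernel has an element nonzero at `t`, simplicity makes its values at `t` dense in `D`, so
some `g` in the kernel is close to `1` near `t`. A tent `X` concentrated there satisfies `X g ≈ X`,
so `ψ X` is small, whereas `t` in the spectrum forces `‖ψ X‖ ≥ 1`. -/
lemma injective_of_spectrum (hD : IsSimpleCStar D) {ψ : Cone D →⋆ₙₐ[ℂ] C}
    (hψ : Set.Ioc 0 1 ⊆ spectrum ℝ (ψ (idTensor 1))) : Function.Injective ψ := by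
  have := hD.1
  refine (injective_iff_map_eq_zero ψ).2 fun F hF => ?_
  by_contra hF0
  obtain ⟨t, ht⟩ : ∃ t, F t ≠ 0 := by
    by_contra! h
    exact hF0 (DFunLike.ext _ _ h)
  have htop : kerValues ψ t = ⊤ := by
    refine (hD.2 _ (by rw [coe_kerValues]; exact isClosed_closure)).resolve_left fun h => ht ?_
    have : F t ∈ (kerValues ψ t : Set D) := by
      rw [coe_kerValues]
      exact subset_closure ⟨F, hF, rfl⟩
    rw [h] at this
    exact (TwoSidedIdeal.mem_bot D).1 this
  have h1 : (1 : D) ∈ (kerValues ψ t : Set D) := by rw [htop]; trivial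
  rw [coe_kerValues] at h1
  obtain ⟨_, ⟨g, hg, rfl⟩, hgt⟩ := Metric.mem_closure_iff.1 h1 (1 / 2) (by norm_num)
  have hgt' : ‖g t - 1‖ < 1 / 2 := by rwa [dist_comm, dist_eq_norm] at hgt
  have hnear : ∀ᶠ x in nhds t, ‖g x - 1‖ < 1 / 2 :=
    (((map_continuous g).sub continuous_const).norm.tendsto t).eventually_lt_const hgt'
  obtain ⟨ε, hε, hball⟩ := Metric.eventually_nhds_iff.1 hnear
  have hδ : 0 < min ε t := lt_min hε t.2.1
  have hf := continuous_tent t (min ε t)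
  have hf0 := tent_zero hδ (min_le_right ε (t : ℝ))
  set X := cfcₙ (tent t (min ε t)) (idTensor (1 : D)) with hX
  have hXle : ‖X * g - X‖ ≤ 1 / 2 := norm_le (by norm_num) fun x => by
    change ‖X x * g x - X x‖ ≤ 1 / 2
    rw [hX, cfcₙ_idTensor_apply hf hf0, smul_one_mul, ← smul_sub, norm_smul,
      Real.norm_of_nonneg (tent_nonneg _ _ _)]
    rcases lt_or_ge (dist x t) ε with hx | hx
    · exact (mul_le_of_le_one_left (norm_nonneg _) (tent_le_one hδ _)).trans (hball hx).le
    · rw [tent_of_le hδ ((min_le_left _ _).trans hx), zero_mul]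
      norm_num
  have hψX : ‖ψ X‖ ≤ 1 / 2 := by
    have h2 : ψ (X * g - X) = -ψ X := by
      rw [map_sub, map_mul, show ψ g = 0 from hg, mul_zero, zero_sub]
    rw [← norm_neg, ← h2]
    exact (NonUnitalStarAlgHom.norm_apply_le ψ _).trans hXle
  have h3 := norm_apply_le_norm_cfc (tent t (min ε t)) (ψ (idTensor 1)) (hψ t.2) hf.continuousOn
    (isSelfAdjoint_idTensor_one.map ψ)
  rw [← map_cfcₙ_idTensor ψ hf hf0, tent_self, norm_one] at h3
  linarith

/-- A *-homomorphism on the cone over a simple C*-algebra is injective if and only if it maps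
`id ⊗ 1` to an element with spectrum `[0,1]`. -/
lemma spectrum_eq_iff_injective (hD : IsSimpleCStar D) (ψ : Cone D →⋆ₙₐ[ℂ] C) :
    spectrum ℂ (ψ (idTensor 1)) = Complex.ofReal '' Set.Icc (0 : ℝ) 1 ↔ Function.Injective ψ := by
  have := hD.1
  have hsa : IsSelfAdjoint (ψ (idTensor (1 : D))) := isSelfAdjoint_idTensor_one.map ψ
  -- Self-adjointness makes the complex spectrum the image of the real one, reducing the claim to
  -- real spectra.
  have himg : Complex.ofReal '' spectrum ℝ (ψ (idTensor (1 : D))) =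
      spectrum ℂ (ψ (idTensor (1 : D))) := hsa.spectrumRestricts.algebraMap_image
  rw [← himg, (Set.image_injective.2 Complex.ofReal_injective).eq_iff]
  exact ⟨fun h => injective_of_spectrum hD (h ▸ Set.Ioc_subset_Icc_self),
    spectrum_map_idTensor_of_injective⟩

end Cone

theorem proposition2p2
    (ω : Ultrafilter ℕ) (hω : (ω : Filter ℕ) ≤ Filter.cofinite)
    {J A B : ℕ → Type*}
    [∀ i, NonUnitalCStarAlgebra (J i)]
    [∀ i, CStarAlgebra (A i)] [∀ i, Nontrivial (A i)]
    [∀ i, CStarAlgebra (B i)] [∀ i, Nontrivial (B i)]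
    [∀ i, PartialOrder (B i)] [∀ i, StarOrderedRing (B i)]
    (ι : ∀ i, J i →⋆ₙₐ[ℂ] A i) (π : ∀ i, A i →⋆ₐ[ℂ] B i)
    (hext : ∀ i, IsUnitalExtension (ι i) (π i))
    (hB : ∀ i, IsKirchberg (B i)) (hJ : ∀ i, IsStableCStar (J i)) :
    (∀ a : Ultraproduct ω A, IsFullElement a ↔ Ultraproduct.map ω π a ≠ 0) ∧
    (∀ {D : Type*} [CStarAlgebra D] [PartialOrder D] [StarOrderedRing D],
      IsSimpleCStar D →
      ∀ φ : D →CP Ultraproduct ω A, IsContractiveMap φ → IsOrderZero φ →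
      ∀ Φ : Cone D →⋆ₙₐ[ℂ] Ultraproduct ω A, (∀ d : D, Φ (idTensor d) = φ d) →
        List.TFAE [
          spectrum ℂ (Ultraproduct.map ω π (φ 1)) = Complex.ofReal '' Set.Icc (0 : ℝ) 1,
          Function.Injective (fun x : Cone D => Ultraproduct.map ω π (Φ x)),
          IsFullHom Φ]) := by
  have hfull := fun a => Ultraproduct.isFullElement_iff_map_ne_zero ω hext
    (fun i => (hB i).simple) (fun i => (hB i).purelyInfinite) hJ a
  refine ⟨hfull, fun {D} _ _ _ hD φ _ _ Φ hΦ => ?_⟩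
  let ψ : Cone D →⋆ₙₐ[ℂ] Ultraproduct ω B :=
    (Ultraproduct.map ω π : Ultraproduct ω A →⋆ₙₐ[ℂ] Ultraproduct ω B).comp Φ
  have hψ : ∀ x, ψ x = Ultraproduct.map ω π (Φ x) := fun _ => rfl
  tfae_have 1 ↔ 2 := by
    rw [← hΦ, ← hψ]
    exact Cone.spectrum_eq_iff_injective hD ψ
  tfae_have 2 ↔ 3 := by
    change Function.Injective ψ ↔ _
    -- By (i), fullness of `Φ x` means `ψ x ≠ 0`, so the two conditions are contrapositives of each
    -- other at every `x`.
    rw [injective_iff_map_eq_zero]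
    refine forall_congr' fun x => ?_
    rw [hfull, ← hψ, not_imp_not]
  tfae_finish
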